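/- **Model.** Let $R\{q\}$ be the rotation matrix of a unit quaternion $q$, $[\omega]_\times$ the cross-product matrix of $\omega\in\mathbb R^3$, and $g=(0,0,9.8)^T$. The state is $x=(p,v,q,b_a,b_\omega,p_U)$: position, velocity and orientation (unit quaternion) of the IMU in the world frame, accelerometer bias, gyroscope bias, and position of the mobile radio in the IMU frame. The input is $u=(a_m,\omega_m)\in\mathbb R^3\times\mathbb R^3$, the accelerometer and gyroscope measurements. The noise-free motion model is $$\dot p=v,\qquad \dot v=R\{q\}(a_m-b_a)-g,\qquad \dot q=\tfrac12\, q\otimes(0,\omega_m-b_\omega),\qquad \dot b_a=\dot b_\omega=\dot p_U=0 .$$ Let $p_A\in\mathbb R^3$ be a fixed anchor. With temporal offset $\tau$, the output at time $t$ is half the squared range, $$y(t)=\tfrac12\,\bigl\|p_A-\hat p_U(t)\bigr\|^2,$$ where $\hat p_U(t)$ is the world position of the radio predicted from $x(t-\tau)$ and $u(t-\tau)$ over the duration $\tau$, in one of two ways: * (exact) $\hat p_U(t)=R\{\hat q\}p_U+\hat p$, where $\hat p,\hat q$ are the position and orientation reached from $x(t-\tau)$ after time $\tau$ of the motion model with the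 input held constant at $u(t-\tau)$; * (first order) $\hat p_U(t)=p+\tau v+\tfrac{\tau^2}{2}\bigl(R\{q\}(a_m-b_a)-g\bigr)+R\{q\}\bigl(I+\tau[\omega_m-b_\omega]_\times\bigr)p_U$, with all quantities taken at time $t-\tau$. **Excitation.** Fix a smooth ($C^\infty$) input $u_0:\mathbb R\to\mathbb R^3\times\mathbb R^3$, and let $E_a,E_\omega\subseteq\{x,y,z\}$ be the sets of excited accelerometer and gyroscope axes. The admissible inputs are the smooth $u$ that agree with $u_0$ on every axis that is not excited; on excited axes they are arbitrary. **Local identifiability.** Let $T\in\mathbb R$ and let $S$ be a set of (true) initial states. The offset is *locally identifiable* at $t_d\in(0,T)$ if there is an open set $W\subseteq(0,T)$ with $t_d\in W$ such that for every $\tau_1\in W\setminus\{t_d\}$, every $\xi_0\in S$ and every state $\xi_1$, there are an admissible input $u$ and a time $t\ge T$ with $$y(t;\xi_0,u,t_d)\ne y(t;\xi_1,u,\tau_1),$$ where $y(\cdot\,;\xi,u,\tau)$ is the output with offset $\tau$ along the solution of the motion model on $[0,\infty)$ with $x(0)=\xi$ and input $u$. **Theorem 1.** Let $t_d\in(0,T)$.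 Suppose * (T1) the radio is not co-located with the anchor: $R\{q\}p_U+p\ne p_A$ for every initial state in $S$; and that one of the following holds: * (T2) at least one accelerometer axis is excited: $E_a\neq\emptyset$; or * (T3) the radio is not co-located with the IMU, $p_U\neq0$ for every initial state in $S$, and all three gyroscope axes are excited: $E_\omega=\{x,y,z\}$. Then $t_d$ is locally identifiable, both for the output with exact propagation and for the output with first-order propagation. -/

import Mathlib

open scoped Quaternion ContDiff

namespace UwbImu

/-- Euclidean three-space. -/
abbrev E3 : Type := EuclideanSpace ℝ (Fin 3)

/-- The pure quaternion with vector part `v`. -/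
def pureQuat (v : E3) : ℍ[ℝ] := ⟨0, v 0, v 1, v 2⟩

/-- The vector part of a quaternion. -/
noncomputable def vecPart (q : ℍ[ℝ]) : E3 := !₂[q.imI, q.imJ, q.imK]

/-- The action `v ↦ q v q*`; for a unit quaternion this is the rotation matrix `R{q}` applied
to `v`. -/
noncomputable def rot (q : ℍ[ℝ]) (v : E3) : E3 := vecPart (q * pureQuat v * star q)

/-- The cross product on Euclidean three-space. -/
noncomputable def cross (a b : E3) : E3 := WithLp.toLp 2 (crossProduct (a : Fin 3 → ℝ) b)

/-- Gravity in the world frame. -/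
noncomputable def gravity : E3 := !₂[0, 0, 9.8]

/-- The state of the system without the temporal offset: position, velocity and orientation of the
IMU in the world frame, accelerometer and gyroscope biases, and the position of the mobile radio
in the IMU frame. -/
structure State where
  p : E3
  v : E3
  q : ℍ[ℝ]
  ba : E3
  bω : E3
  pU : E3

/-- The inputs: the accelerometer and gyroscope measurements `a_m` and `ω_m`. -/
structure Input where
  acc : E3
  gyro : E3

/-- The bias-corrected (true) acceleration `a_t = a_m - b_a`. -/
noncomputable def trueAcc (x : State) (u : Input) : E3 := u.acc - x.ba

/-- The bias-corrected (true) angular velocity `ω_t = ω_m - b_ω`. -/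
noncomputable def trueGyro (x : State) (u : Input) : E3 := u.gyro - x.bω

/-- The position of the mobile radio in the world frame, `p_U^W = R{q} p_U^I + p_I^W`. -/
noncomputable def radioPos (x : State) : E3 := rot x.q x.pU + x.p

/-- `X` solves the noise-free motion model on `[0, ∞)` with input `u` and initial state `ξ`.
The quaternion equation is `q' = (1/2) Ω(ω_t) q`, where `Ω(ω) q = q ⊗ (0, ω)`. -/
structure IsTrajectory (u : ℝ → Input) (ξ : State) (X : ℝ → State) : Prop where
  init : X 0 = ξ
  pos : ∀ t, 0 ≤ t → HasDerivWithinAt (fun s => (X s).p) (X t).v (Set.Ici 0) t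
  vel : ∀ t, 0 ≤ t → HasDerivWithinAt (fun s => (X s).v)
    (rot (X t).q (trueAcc (X t) (u t)) - gravity) (Set.Ici 0) t
  ori : ∀ t, 0 ≤ t → HasDerivWithinAt (fun s => (X s).q)
    ((1 / 2 : ℝ) • ((X t).q * pureQuat (trueGyro (X t) (u t)))) (Set.Ici 0) t
  accBias : ∀ t, 0 ≤ t → HasDerivWithinAt (fun s => (X s).ba) 0 (Set.Ici 0) t
  gyroBias : ∀ t, 0 ≤ t → HasDerivWithinAt (fun s => (X s).bω) 0 (Set.Ici 0) t
  extrinsic : ∀ t, 0 ≤ t → HasDerivWithinAt (fun s => (X s).pU) 0 (Set.Ici 0) t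

/-- Orientation after propagating `x` for `s` seconds with the input held at `u`. -/
noncomputable def heldOri (x : State) (u : Input) (s : ℝ) : ℍ[ℝ] :=
  x.q * NormedSpace.exp (s • ((1 / 2 : ℝ) • pureQuat (trueGyro x u)))

/-- Velocity after propagating `x` for `s` seconds with the input held at `u`. -/
noncomputable def heldVel (x : State) (u : Input) (s : ℝ) : E3 :=
  x.v + ∫ r in (0 : ℝ)..s, (rot (heldOri x u r) (trueAcc x u) - gravity)

/-- Position after propagating `x` for `s` seconds with the input held at `u`. -/
noncomputable def heldPos (x : State) (u : Input) (s : ℝ) : E3 :=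
  x.p + ∫ r in (0 : ℝ)..s, heldVel x u r

/-- The state reached from `x` after `s` seconds of the motion model with the input held constant
at `u` (see `held_isTrajectory`). -/
noncomputable def held (x : State) (u : Input) (s : ℝ) : State where
  p := heldPos x u s
  v := heldVel x u s
  q := heldOri x u s
  ba := x.ba
  bω := x.bω
  pU := x.pU

/-- The observation model: half the squared range between the anchor and the mobile radio at the
reference time `t_r`, computed from the state `x` and the input `u` at time `t_r - τ` by propagating
for `τ` seconds with the motion model and the input held at `u`. -/
noncomputable def rangeOutput (anchor : E3) (x : State) (u : Input) (τ : ℝ) : ℝ :=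
  (1 / 2) * ‖anchor - radioPos (held x u τ)‖ ^ 2

/-- First-order (Euler / truncated exponential) prediction of the position of the radio, `τ` seconds
ahead:
`p + τ v + (τ²/2) (R a_t - g) + R (1 + τ [ω_t]×) p_U`. -/
noncomputable def radioPosEuler (x : State) (u : Input) (τ : ℝ) : E3 :=
  x.p + τ • x.v + (τ ^ 2 / 2) • (rot x.q (trueAcc x u) - gravity)
    + rot x.q (x.pU + τ • cross (trueGyro x u) x.pU)

/-- The observation model with the first-order propagation. -/
noncomputable def rangeOutputEuler (anchor : E3) (x : State) (u : Input) (τ : ℝ) : ℝ :=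
  (1 / 2) * ‖anchor - radioPosEuler x u τ‖ ^ 2

/-- The smooth inputs in which the accelerometer axes in `Ea` and the gyroscope axes in `Eω` are
excited, that is, can be varied freely, while every other axis follows the signal `u₀`. -/
def excitedInputs (Ea Eω : Set (Fin 3)) (u₀ : ℝ → Input) : Set (ℝ → Input) :=
  {u | ContDiff ℝ ∞ (fun t => (u t).acc) ∧ ContDiff ℝ ∞ (fun t => (u t).gyro) ∧
    (∀ j, j ∉ Ea → ∀ t, (u t).acc j = (u₀ t).acc j) ∧
    (∀ j, j ∉ Eω → ∀ t, (u t).gyro j = (u₀ t).gyro j)}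

/-- Local identifiability of the delay at `τ₀ ∈ (0, T)`, for the motion model with output
`y(t) = H (x(t - τ)) (u(t - τ)) τ`, admissible inputs `U` and set `S` of true initial states:
there is an open `W ⊆ (0, T)` containing `τ₀` such that for every other delay `τ₁ ∈ W`, every true
initial state `ξ₀ ∈ S` and every alternative initial state `ξ₁`, some admissible input produces
different outputs, at some time `t ≥ T`, for `(ξ₀, τ₀)` and `(ξ₁, τ₁)`. For `t ≥ T` both outputs use
only data of the motion from time `0` on. -/
def LocallyIdentifiable (H : State → Input → ℝ → ℝ) (U : Set (ℝ → Input)) (S : Set State)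
    (T τ₀ : ℝ) : Prop :=
  ∃ W : Set ℝ, IsOpen W ∧ τ₀ ∈ W ∧ W ⊆ Set.Ioo 0 T ∧
    ∀ τ₁ ∈ W, τ₁ ≠ τ₀ → ∀ ξ₀ ∈ S, ∀ ξ₁ : State, ‖ξ₁.q‖ = 1 →
      ∃ u ∈ U, ∃ X₀ X₁ : ℝ → State, IsTrajectory u ξ₀ X₀ ∧ IsTrajectory u ξ₁ X₁ ∧
        ∃ t, T ≤ t ∧
          H (X₀ (t - τ₀)) (u (t - τ₀)) τ₀ ≠ H (X₁ (t - τ₁)) (u (t - τ₁)) τ₁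

theorem continuous_rot {f : ℝ → ℍ[ℝ]} (hf : Continuous f) (v : E3) :
    Continuous (fun s => rot (f s) v) := by
  have h : Continuous (fun s => f s * pureQuat v * star (f s)) :=
    (hf.mul continuous_const).mul (continuous_star.comp hf)
  unfold rot vecPart
  refine (PiLp.continuous_toLp 2 _).comp (continuous_pi fun i => ?_)
  fin_cases i
  · exact Quaternion.continuous_imI.comp h
  · exact Quaternion.continuous_imJ.comp h
  · exact Quaternion.continuous_imK.comp h

/-- `held x u` is the solution of the motion model that starts at `x` with constant input `u`. -/
theorem held_isTrajectory (x : State) (u : Input) : IsTrajectory (fun _ => u) x (held x u) := by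
  have hq : ∀ t, HasDerivAt (heldOri x u)
      ((1 / 2 : ℝ) • (heldOri x u t * pureQuat (trueGyro x u))) t := by
    intro t
    have h := (hasDerivAt_exp_smul_const (𝕂 := ℝ) ((1 / 2 : ℝ) • pureQuat (trueGyro x u)) t)
    have h2 := h.const_mul x.q
    have e : (1 / 2 : ℝ) • (heldOri x u t * pureQuat (trueGyro x u)) =
        x.q * (NormedSpace.exp (t • ((1 / 2 : ℝ) • pureQuat (trueGyro x u))) *
          ((1 / 2 : ℝ) • pureQuat (trueGyro x u))) := by
      rw [heldOri, mul_smul_comm, mul_smul_comm, mul_assoc]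
    rw [e]
    exact h2
  have hqc : Continuous (heldOri x u) :=
    continuous_iff_continuousAt.2 fun t => (hq t).continuousAt
  have hc : Continuous (fun r => rot (heldOri x u r) (trueAcc x u) - gravity) :=
    (continuous_rot hqc _).sub continuous_const
  have hv : ∀ t, HasDerivAt (heldVel x u) (rot (heldOri x u t) (trueAcc x u) - gravity) t :=
    fun t => (hc.integral_hasStrictDerivAt 0 t).hasDerivAt.const_add x.v
  have hvc : Continuous (heldVel x u) :=
    continuous_iff_continuousAt.2 fun t => (hv t).continuousAt
  have hp : ∀ t, HasDerivAt (heldPos x u) (heldVel x u t) t :=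
    fun t => (hvc.integral_hasStrictDerivAt 0 t).hasDerivAt.const_add x.p
  constructor
  · simp [held, heldPos, heldVel, heldOri]
  · exact fun t _ => (hp t).hasDerivWithinAt
  · exact fun t _ => (hv t).hasDerivWithinAt
  · exact fun t _ => (hq t).hasDerivWithinAt
  · exact fun t _ => hasDerivWithinAt_const _ _ _
  · exact fun t _ => hasDerivWithinAt_const _ _ _
  · exact fun t _ => hasDerivWithinAt_const _ _ _

end UwbImu

namespace UwbImu

open Filter Topology

/-! The output with offset `τ` at time `t` reads the input directly at the single instant `t - τ`;
its other dependence on the input is through the state, that is, through integrals. Modify the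
reference input by a bump of shrinking width centred at `t - td` and of fixed height. In the limit
the trajectories of both candidate systems return to the reference ones, and for `τ₁ ≠ td` the
sample at `t - τ₁` is eventually untouched. The true output, however, keeps the modified sample. If
the two outputs agreed for every admissible input, the true output at reference state would not
depend on the excited components of its sample (`locallyIdentifiable_of_sensitive`, resting on
`tendsto_motion`).

It remains to find a time at which it does depend on them. Both models have the form `bodyOutput B`,
the length of a fixed vector minus a rotated body-frame prediction `B`. In the acceleration, and for
the first-order model also in the angular velocity, `B` is affine with nonzero slope along a
suitable line, and no line lies on a sphere (`drift_ne_zero`, `exists_norm_add_smul_ne`). For the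
exact model and the angular velocity, full turns detect a nonzero acceleration and half turns detect
the lever arm of the radio when the acceleration is zero and the anchor offset is not. Both cannot
vanish at all late times, because of gravity (`exists_anchorOffset_ne_zero_or_trueAcc_ne_zero`). -/

/-! ### Quaternions acting on three-space. -/

@[simp] theorem pureQuat_re (v : E3) : (pureQuat v).re = 0 := rfl

@[simp] theorem pureQuat_imI (v : E3) : (pureQuat v).imI = v 0 := rfl

@[simp] theorem pureQuat_imJ (v : E3) : (pureQuat v).imJ = v 1 := rfl

@[simp] theorem pureQuat_imK (v : E3) : (pureQuat v).imK = v 2 := rfl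

/-- The inclusion of three-space as pure quaternions, as a linear map. -/
noncomputable def pureQuatL : E3 →ₗ[ℝ] ℍ[ℝ] where
  toFun := pureQuat
  map_add' v w := by ext <;> simp
  map_smul' c v := by ext <;> simp

/-- The vector part of a quaternion, as a linear map. -/
noncomputable def vecPartL : ℍ[ℝ] →ₗ[ℝ] E3 where
  toFun := vecPart
  map_add' p q := by ext i; fin_cases i <;> simp [vecPart]
  map_smul' c p := by ext i; fin_cases i <;> simp [vecPart]

theorem pureQuat_add (v w : E3) : pureQuat (v + w) = pureQuat v + pureQuat w :=
  map_add pureQuatL v w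

theorem pureQuat_sub (v w : E3) : pureQuat (v - w) = pureQuat v - pureQuat w :=
  map_sub pureQuatL v w

theorem pureQuat_smul (c : ℝ) (v : E3) : pureQuat (c • v) = c • pureQuat v :=
  map_smul pureQuatL c v

theorem pureQuat_zero : pureQuat 0 = 0 := map_zero pureQuatL

theorem continuous_pureQuat : Continuous pureQuat :=
  (LinearMap.toContinuousLinearMap pureQuatL).continuous

theorem continuous_vecPart : Continuous vecPart :=
  (LinearMap.toContinuousLinearMap vecPartL).continuous

theorem star_pureQuat (v : E3) : star (pureQuat v) = -pureQuat v := by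
  ext <;> simp

theorem norm_pureQuat (v : E3) : ‖pureQuat v‖ = ‖v‖ := by
  have h : ‖pureQuat v‖ ^ 2 = ‖v‖ ^ 2 := by
    rw [EuclideanSpace.norm_sq_eq, sq, ← Quaternion.normSq_eq_norm_mul_self,
      Quaternion.normSq_def', Fin.sum_univ_three]
    simp
  exact (sq_eq_sq₀ (norm_nonneg _) (norm_nonneg _)).1 h

theorem pureQuat_vecPart {q : ℍ[ℝ]} (hq : q.re = 0) : pureQuat (vecPart q) = q := by
  ext <;> simp [vecPart, hq]

theorem vecPart_pureQuat (v : E3) : vecPart (pureQuat v) = v := by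
  ext i; fin_cases i <;> simp [vecPart]

theorem re_mul_pureQuat_mul_star (q : ℍ[ℝ]) (v : E3) : (q * pureQuat v * star q).re = 0 := by
  simp; ring

theorem pureQuat_rot (q : ℍ[ℝ]) (v : E3) : pureQuat (rot q v) = q * pureQuat v * star q :=
  pureQuat_vecPart (re_mul_pureQuat_mul_star q v)

/-- The action of a quaternion on three-space, as a linear map. -/
noncomputable def rotL (q : ℍ[ℝ]) : E3 →ₗ[ℝ] E3 where
  toFun := rot q
  map_add' v w := by
    simp only [rot, pureQuat_add, mul_add, add_mul]
    exact map_add vecPartL _ _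
  map_smul' c v := by
    simp only [rot, pureQuat_smul, mul_smul_comm, smul_mul_assoc]
    exact map_smul vecPartL _ _

theorem rot_add (q : ℍ[ℝ]) (v w : E3) : rot q (v + w) = rot q v + rot q w := map_add (rotL q) v w

theorem rot_sub (q : ℍ[ℝ]) (v w : E3) : rot q (v - w) = rot q v - rot q w := map_sub (rotL q) v w

theorem rot_smul (q : ℍ[ℝ]) (c : ℝ) (v : E3) : rot q (c • v) = c • rot q v :=
  map_smul (rotL q) c v

theorem rot_zero (q : ℍ[ℝ]) : rot q 0 = 0 := map_zero (rotL q)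

theorem rot_one (v : E3) : rot 1 v = v := by simp [rot, vecPart_pureQuat]

theorem rot_neg_one (v : E3) : rot (-1) v = v := by simp [rot, vecPart_pureQuat]

theorem rot_mul (p q : ℍ[ℝ]) (v : E3) : rot (p * q) v = rot p (rot q v) := by
  rw [rot, rot, pureQuat_rot, star_mul]
  simp only [mul_assoc]

theorem norm_rot {q : ℍ[ℝ]} (hq : ‖q‖ = 1) (v : E3) : ‖rot q v‖ = ‖v‖ := by
  rw [← norm_pureQuat, pureQuat_rot, norm_mul, norm_mul, norm_star, hq, norm_pureQuat]; ring

theorem inner_rot {q : ℍ[ℝ]} (hq : ‖q‖ = 1) (v w : E3) :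
    inner ℝ (rot q v) (rot q w) = inner ℝ v w :=
  LinearIsometry.inner_map_map (⟨rotL q, norm_rot hq⟩ : E3 →ₗᵢ[ℝ] E3) v w

theorem continuous_rot_prod : Continuous (fun z : ℍ[ℝ] × E3 => rot z.1 z.2) :=
  continuous_vecPart.comp ((continuous_fst.mul (continuous_pureQuat.comp continuous_snd)).mul
    (continuous_star.comp continuous_fst))

theorem continuous_rot_left (v : E3) : Continuous (fun q => rot q v) :=
  continuous_vecPart.comp ((continuous_id.mul continuous_const).mul continuous_star)

theorem mul_star_of_norm_one {q : ℍ[ℝ]} (hq : ‖q‖ = 1) : q * star q = 1 := by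
  rw [Quaternion.self_mul_star, Quaternion.normSq_eq_norm_mul_self, hq]; simp

theorem star_mul_of_norm_one {q : ℍ[ℝ]} (hq : ‖q‖ = 1) : star q * q = 1 := by
  rw [Quaternion.star_mul_self, Quaternion.normSq_eq_norm_mul_self, hq]; simp

/-- The factor `1 / 2` of the kinematic equation absorbs the `2` in the commutator of pure
quaternions; this turns the equation for `Q` into one with cross products in `HasDerivAt.rot_frame`.
-/
theorem pureQuat_mul_sub_mul (v w : E3) :
    (1 / 2 : ℝ) • (pureQuat v * pureQuat w - pureQuat w * pureQuat v) = pureQuat (cross v w) := by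
  ext <;> simp [cross, cross_apply] <;> ring

theorem cross_self (v : E3) : cross v v = 0 := by simp [cross]

theorem cross_smul_left (c : ℝ) (v w : E3) : cross (c • v) w = c • cross v w := by simp [cross]

theorem cross_add_left (u v w : E3) : cross (u + v) w = cross u w + cross v w := by simp [cross]

theorem inner_eq_sum (v w : E3) : inner ℝ v w = v 0 * w 0 + v 1 * w 1 + v 2 * w 2 := by
  simp [PiLp.inner_apply, Fin.sum_univ_three]; ring

theorem inner_cross_self_left (v w : E3) : inner ℝ v (cross v w) = 0 := by
  simp [inner_eq_sum, cross, cross_apply]; ring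

theorem inner_cross_self_right (v w : E3) : inner ℝ w (cross v w) = 0 := by
  simp [inner_eq_sum, cross, cross_apply]; ring

theorem cross_cross_self (v w : E3) :
    cross v (cross v w) = (inner ℝ v w : ℝ) • v - (‖v‖ ^ 2) • w := by
  rw [EuclideanSpace.norm_sq_eq, Fin.sum_univ_three]
  ext i
  fin_cases i <;> simp [inner_eq_sum, cross, cross_apply] <;> ring

theorem norm_cross_sq (v w : E3) :
    ‖cross v w‖ ^ 2 = ‖v‖ ^ 2 * ‖w‖ ^ 2 - (inner ℝ v w : ℝ) ^ 2 := by
  simp only [EuclideanSpace.norm_sq_eq, Fin.sum_univ_three]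
  simp [inner_eq_sum, cross, cross_apply]; ring

theorem exists_cross_ne_zero {w : E3} (hw : w ≠ 0) : ∃ v : E3, cross v w ≠ 0 := by
  by_contra! h
  apply hw
  have h0 := h (EuclideanSpace.single 0 1)
  have h1 := h (EuclideanSpace.single 1 1)
  have a1 := congrArg (fun z : E3 => z 1) h0
  have a2 := congrArg (fun z : E3 => z 2) h0
  have a3 := congrArg (fun z : E3 => z 2) h1
  simp [cross, cross_apply] at a1 a2 a3
  ext i
  fin_cases i <;> simp [a1, a2, a3]

theorem exists_unit_orthogonal (w : E3) : ∃ n : E3, ‖n‖ = 1 ∧ inner ℝ n w = 0 := by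
  by_cases hw : w = 0
  · exact ⟨EuclideanSpace.single 0 1, by simp, by simp [hw]⟩
  obtain ⟨v, hv⟩ := exists_cross_ne_zero hw
  refine ⟨‖cross v w‖⁻¹ • cross v w, ?_, ?_⟩
  · rw [norm_smul, norm_inv, norm_norm, inv_mul_cancel₀ (norm_ne_zero_iff.2 hv)]
  · rw [real_inner_smul_left, real_inner_comm, inner_cross_self_right, mul_zero]

/-- A half turn about the unit vector `n`. -/
theorem rot_pureQuat {n : E3} (hn : ‖n‖ = 1) (v : E3) :
    rot (pureQuat n) v = (2 * inner ℝ n v : ℝ) • n - v := by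
  have h : n 0 ^ 2 + n 1 ^ 2 + n 2 ^ 2 = 1 := by
    have := EuclideanSpace.norm_sq_eq n
    rw [hn, Fin.sum_univ_three] at this
    simpa using this.symm
  have h0 : n 0 ^ 2 = 1 - n 1 ^ 2 - n 2 ^ 2 := by linarith
  ext i
  fin_cases i <;> simp [rot, vecPart, inner_eq_sum] <;> ring_nf <;> rw [h0] <;> ring

/-! ### The quaternion kinematic equation: existence, uniqueness, continuous dependence. -/

/-- Conjugation of quaternions, as a linear map. -/
noncomputable def starL : ℍ[ℝ] →ₗ[ℝ] ℍ[ℝ] where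
  toFun := star
  map_add' p q := star_add p q
  map_smul' c p := by ext <;> simp

theorem star_smul_quaternion (c : ℝ) (q : ℍ[ℝ]) : star (c • q) = c • star q := map_smul starL c q

theorem HasDerivAt.star_quaternion {Q : ℝ → ℍ[ℝ]} {Q' : ℍ[ℝ]} {t : ℝ} (hQ : HasDerivAt Q Q' t) :
    HasDerivAt (fun s => star (Q s)) (star Q') t :=
  (LinearMap.toContinuousLinearMap starL).hasFDerivAt.comp_hasDerivAt t hQ

/-- Derivative of a vector carried along by a rotating frame. -/
theorem HasDerivAt.rot_frame {Q : ℝ → ℍ[ℝ]} {w : E3} {t : ℝ}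
    (hQ : HasDerivAt Q ((1 / 2 : ℝ) • (Q t * pureQuat w)) t) (a : E3) :
    HasDerivAt (fun s => rot (Q s) a) (rot (Q t) (cross w a)) t := by
  have h := (hQ.mul_const (pureQuat a)).mul (HasDerivAt.star_quaternion hQ)
  have h2 : HasDerivAt (fun s => rot (Q s) a) (vecPart _) t :=
    (LinearMap.toContinuousLinearMap vecPartL).hasFDerivAt.comp_hasDerivAt t h
  convert h2 using 1
  rw [rot, ← pureQuat_mul_sub_mul]
  congr 1
  simp only [star_smul_quaternion, star_mul, star_pureQuat, mul_smul_comm, smul_mul_assoc,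
    mul_add, add_mul, smul_add, mul_assoc, neg_mul, mul_neg, smul_neg, sub_eq_add_neg]

/-- The quaternion kinematic equation on a set of times. -/
def IsOrientationOn (w : ℝ → E3) (Q : ℝ → ℍ[ℝ]) (s : Set ℝ) : Prop :=
  ∀ t ∈ s, HasDerivAt Q ((1 / 2 : ℝ) • (Q t * pureQuat (w t))) t

theorem eq_of_hasDerivAt_zero_Ioo {E : Type*} [NormedAddCommGroup E] [NormedSpace ℝ E]
    {f : ℝ → E} {N : ℝ} (h : ∀ t ∈ Set.Ioo (-N) N, HasDerivAt f 0 t) {t : ℝ}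
    (ht : t ∈ Set.Ioo (-N) N) : f t = f 0 :=
  isOpen_Ioo.is_const_of_deriv_eq_zero isPreconnected_Ioo
    (fun s hs => (h s hs).differentiableAt.differentiableWithinAt) (fun s hs => (h s hs).deriv) ht
    ⟨by linarith [ht.1, ht.2], by linarith [ht.1, ht.2]⟩

theorem norm_eq_one_of_mul_star {q : ℍ[ℝ]} (h : q * star q = 1) : ‖q‖ = 1 := by
  have h1 := congrArg norm h
  rw [norm_mul, norm_star, norm_one] at h1
  nlinarith [norm_nonneg q]

/-- Local solutions exist on every bounded interval. The equation is solved with the bounded field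
`(1 + ‖q‖²)⁻¹ q ω`, which preserves the norm and so agrees with `½ q ω` along unit quaternions. -/
theorem exists_isOrientationOn_Ioo {w : ℝ → E3} (hw : Continuous w) {q₀ : ℍ[ℝ]} (hq₀ : ‖q₀‖ = 1)
    {N : ℝ} (hN : 0 < N) :
    ∃ Q : ℝ → ℍ[ℝ], Q 0 = q₀ ∧ IsOrientationOn w Q (Set.Ioo (-N) N) ∧
      ∀ t ∈ Set.Ioo (-N) N, ‖Q t‖ = 1 := by
  obtain ⟨C, hC⟩ := (isCompact_Icc (a := -N) (b := N)).exists_bound_of_continuousOn hw.continuousOn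
  have hC0 : 0 ≤ C := (norm_nonneg _).trans (hC 0 ⟨by linarith, hN.le⟩)
  lift C to NNReal using hC0
  let h : ℍ[ℝ] → ℍ[ℝ] := fun q => (1 + ‖q‖ ^ 2)⁻¹ • q
  have hpos : ∀ q : ℍ[ℝ], 0 < 1 + ‖q‖ ^ 2 := fun q => by positivity
  have hh : ContDiff ℝ 1 h :=
    ((contDiff_const.add (contDiff_norm_sq ℝ)).inv fun q => (hpos q).ne').smul contDiff_id
  have hh1 : ∀ q, ‖h q‖ ≤ 1 := by
    intro q
    rw [norm_smul, norm_inv, Real.norm_of_nonneg (hpos q).le, inv_mul_le_iff₀ (hpos q)]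
    nlinarith [sq_nonneg (‖q‖ - 1)]
  -- The field is bounded by `C`, so up to time `N` a solution cannot leave the ball of radius `C *
  -- N`; this is what lets Picard–Lindelöf cover the whole interval.
  let a : NNReal := C * ⟨N, hN.le⟩
  have : ProperSpace ℍ[ℝ] := FiniteDimensional.proper ℝ ℍ[ℝ]
  obtain ⟨K, hK⟩ := (hh.locallyLipschitz.locallyLipschitzOn
    (s := Metric.closedBall q₀ a)).exists_lipschitzOnWith_of_compact (isCompact_closedBall _ _)
  have hPL : IsPicardLindelof (fun t q => h q * pureQuat (w t)) (tmin := -N) (tmax := N)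
      ⟨0, by linarith, hN.le⟩ q₀ a 0 C (K * C) := by
    refine ⟨fun t ht => ?_, fun x _ => ?_, fun t ht x _ => ?_, ?_⟩
    · refine LipschitzOnWith.of_dist_le_mul fun x hx y hy => ?_
      rw [dist_eq_norm, ← sub_mul, norm_mul, norm_pureQuat, ← dist_eq_norm]
      have := hK.dist_le_mul x hx y hy
      calc dist (h x) (h y) * ‖w t‖ ≤ (K * dist x y) * C :=
            mul_le_mul this (hC t ht) (norm_nonneg _) (by positivity)
        _ = _ := by push_cast; ring
    · exact (continuous_const.mul (continuous_pureQuat.comp hw)).continuousOn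
    · rw [norm_mul, norm_pureQuat]
      calc ‖h x‖ * ‖w t‖ ≤ 1 * C := mul_le_mul (hh1 x) (hC t ht) (norm_nonneg _) zero_le_one
        _ = C := one_mul _
    · simp only [sub_zero, zero_sub, neg_neg, max_self, NNReal.coe_zero]
      exact (NNReal.coe_mul C ⟨N, hN.le⟩).ge
  obtain ⟨Q, hQ0, hQ⟩ := hPL.exists_eq_forall_mem_Icc_hasDerivWithinAt₀
  have hQd : ∀ t ∈ Set.Ioo (-N) N, HasDerivAt Q (h (Q t) * pureQuat (w t)) t := fun t ht =>
    (hQ t ⟨ht.1.le, ht.2.le⟩).hasDerivAt (Icc_mem_nhds ht.1 ht.2)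
  have hQ0' : Q 0 = q₀ := hQ0
  have hn : ∀ t ∈ Set.Ioo (-N) N, ‖Q t‖ = 1 := by
    intro t ht
    apply norm_eq_one_of_mul_star
    rw [← mul_star_of_norm_one hq₀, ← hQ0']
    -- The norm is conserved because pure quaternions are skew under conjugation and the damping
    -- factor is real.
    refine eq_of_hasDerivAt_zero_Ioo (f := fun s => Q s * star (Q s)) (fun s hs => ?_) ht
    refine ((hQd s hs).mul (HasDerivAt.star_quaternion (hQd s hs))).congr_deriv ?_
    simp [h, star_pureQuat, mul_assoc]
  refine ⟨Q, hQ0', fun t ht => ?_, hn⟩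
  convert hQd t ht using 1
  simp only [h, hn t ht, smul_mul_assoc]
  norm_num

/-- The relative orientation sees only the difference of the angular velocities. With equal
velocities this gives uniqueness, with nearby ones continuous dependence, in both cases without
Gronwall. -/
theorem IsOrientationOn.hasDerivAt_mul_star {w w' : ℝ → E3} {Q Q' : ℝ → ℍ[ℝ]} {s : Set ℝ}
    (hQ : IsOrientationOn w Q s) (hQ' : IsOrientationOn w' Q' s) {t : ℝ} (ht : t ∈ s) :
    HasDerivAt (fun r => Q r * star (Q' r))
      ((1 / 2 : ℝ) • (Q t * pureQuat (w t - w' t) * star (Q' t))) t := by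
  refine ((hQ t ht).mul (HasDerivAt.star_quaternion (hQ' t ht))).congr_deriv ?_
  simp only [star_smul_quaternion, star_mul, star_pureQuat, pureQuat_sub, mul_smul_comm,
    smul_mul_assoc, mul_sub, sub_mul, smul_sub, neg_mul, mul_neg, smul_neg, mul_assoc,
    ← sub_eq_add_neg]

theorem IsOrientationOn.eq_of_eq_zero {w : ℝ → E3} {Q Q' : ℝ → ℍ[ℝ]} {N : ℝ}
    (hQ : IsOrientationOn w Q (Set.Ioo (-N) N)) (hQ' : IsOrientationOn w Q' (Set.Ioo (-N) N))
    (hn' : ∀ t ∈ Set.Ioo (-N) N, ‖Q' t‖ = 1) (h0 : Q 0 = Q' 0) {t : ℝ}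
    (ht : t ∈ Set.Ioo (-N) N) : Q t = Q' t := by
  have h := eq_of_hasDerivAt_zero_Ioo (f := fun s => Q s * star (Q' s)) (fun s hs => by
    simpa [pureQuat_zero] using hQ.hasDerivAt_mul_star hQ' hs) ht
  have hz : (0 : ℝ) ∈ Set.Ioo (-N) N := ⟨by linarith [ht.1, ht.2], by linarith [ht.1, ht.2]⟩
  simp only [h0, mul_star_of_norm_one (hn' 0 hz)] at h
  calc Q t = Q t * star (Q' t) * Q' t := by
        rw [mul_assoc, star_mul_of_norm_one (hn' t ht), mul_one]
    _ = Q' t := by rw [h, one_mul]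

/-- Solutions on the intervals of radius `n + 1` agree on overlaps by uniqueness, so they glue; at
time `t` the one of index `⌈|t|⌉₊` is used. -/
theorem exists_isOrientationOn_univ {w : ℝ → E3} (hw : Continuous w) {q₀ : ℍ[ℝ]}
    (hq₀ : ‖q₀‖ = 1) :
    ∃ Q : ℝ → ℍ[ℝ], Q 0 = q₀ ∧ IsOrientationOn w Q Set.univ ∧ ∀ t, ‖Q t‖ = 1 := by
  choose P hP0 hP hPn using fun n : ℕ =>
    exists_isOrientationOn_Ioo hw hq₀ (N := (n : ℝ) + 1) (by positivity)
  let k : ℝ → ℕ := fun t => ⌈|t|⌉₊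
  have hk : ∀ t, t ∈ Set.Ioo (-((k t : ℝ) + 1)) ((k t : ℝ) + 1) := fun t =>
    abs_lt.1 ((Nat.le_ceil |t|).trans_lt (lt_add_one _))
  have hP_eq : ∀ (n : ℕ) (t : ℝ), t ∈ Set.Ioo (-((n : ℝ) + 1)) ((n : ℝ) + 1) → P (k t) t = P n t := by
    intro n t ht
    have hmem : t ∈ Set.Ioo (-((min (k t) n : ℕ) + 1 : ℝ)) ((min (k t) n : ℕ) + 1) := by
      rcases min_choice (k t) n with h | h <;> rw [h]
      exacts [hk t, ht]
    have hsub : ∀ m : ℕ, min (k t) n ≤ m →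
        Set.Ioo (-((min (k t) n : ℕ) + 1 : ℝ)) ((min (k t) n : ℕ) + 1) ⊆
          Set.Ioo (-((m : ℝ) + 1)) ((m : ℝ) + 1) := fun m hm => by
      have : ((min (k t) n : ℕ) : ℝ) ≤ m := by exact_mod_cast hm
      exact Set.Ioo_subset_Ioo (by linarith) (by linarith)
    exact IsOrientationOn.eq_of_eq_zero
      (fun s hs => hP (k t) s (hsub _ (min_le_left _ _) hs))
      (fun s hs => hP n s (hsub _ (min_le_right _ _) hs))
      (fun s hs => hPn n s (hsub _ (min_le_right _ _) hs)) ((hP0 _).trans (hP0 _).symm) hmem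
  refine ⟨fun t => P (k t) t, hP0 _, fun t _ => ?_, fun t => hPn _ _ (hk t)⟩
  refine (hP (k t) t (hk t)).congr_of_eventuallyEq ?_
  filter_upwards [Ioo_mem_nhds (hk t).1 (hk t).2] with s hs using hP_eq _ _ hs

/-- Orientations depend continuously on the angular velocity. -/
theorem tendsto_orientation {w : ℝ → E3} {W : ℕ → ℝ → E3} {Q : ℝ → ℍ[ℝ]} {P : ℕ → ℝ → ℍ[ℝ]}
    (hw : Continuous w) (hW : ∀ n, Continuous (W n)) (hQ : IsOrientationOn w Q Set.univ)
    (hP : ∀ n, IsOrientationOn (W n) (P n) Set.univ) (hQn : ∀ t, ‖Q t‖ = 1)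
    (hPn : ∀ n t, ‖P n t‖ = 1) (h0 : ∀ n, P n 0 = Q 0) {C : ℝ} (hC : ∀ n t, ‖W n t - w t‖ ≤ C)
    (hlim : ∀ᵐ t, Tendsto (fun n => W n t) atTop (𝓝 (w t))) (t : ℝ) :
    Tendsto (fun n => P n t) atTop (𝓝 (Q t)) := by
  have hQc : Continuous Q := continuous_iff_continuousAt.2 fun t => (hQ t trivial).continuousAt
  have hPc : ∀ n, Continuous (P n) := fun n =>
    continuous_iff_continuousAt.2 fun t => (hP n t trivial).continuousAt
  -- `F n` is the derivative of `P n * star Q`. As all orientations are unit, its norm is half the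
  -- velocity error, so dominated convergence drives the relative orientation to `1`.
  let F : ℕ → ℝ → ℍ[ℝ] := fun n s => (1 / 2 : ℝ) • (P n s * pureQuat (W n s - w s) * star (Q s))
  have hFc : ∀ n, Continuous (F n) := fun n =>
    (((hPc n).mul (continuous_pureQuat.comp ((hW n).sub hw))).mul
      (continuous_star.comp hQc)).const_smul (1 / 2 : ℝ)
  have hFnorm : ∀ n s, ‖F n s‖ = 1 / 2 * ‖W n s - w s‖ := fun n s => by
    simp only [F, norm_smul, norm_mul, norm_star, hPn, hQn, norm_pureQuat]; norm_num
  have hint : ∀ n, ∫ s in (0 : ℝ)..t, F n s = P n t * star (Q t) - 1 := by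
    intro n
    rw [intervalIntegral.integral_eq_sub_of_hasDerivAt
      (fun s _ => (hP n).hasDerivAt_mul_star hQ (Set.mem_univ s))
      ((hFc n).intervalIntegrable _ _), h0, mul_star_of_norm_one (hQn 0)]
  have h1 : Tendsto (fun n => ∫ s in (0 : ℝ)..t, F n s) atTop
      (𝓝 (∫ _ in (0 : ℝ)..t, (0 : ℍ[ℝ]))) := by
    refine intervalIntegral.tendsto_integral_filter_of_dominated_convergence (fun _ => 1 / 2 * C)
      (Eventually.of_forall fun n => (hFc n).aestronglyMeasurable)
      (Eventually.of_forall fun n => Eventually.of_forall fun s _ => ?_)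
      intervalIntegrable_const ?_
    · rw [hFnorm]; linarith [hC n s]
    · filter_upwards [hlim] with s hs _
      rw [tendsto_zero_iff_norm_tendsto_zero]
      simp only [hFnorm]
      simpa only [mul_zero] using (tendsto_iff_norm_sub_tendsto_zero.1 hs).const_mul (1 / 2 : ℝ)
  have h2 : Tendsto (fun n => (∫ s in (0 : ℝ)..t, F n s + 0) * Q t + Q t) atTop
      (𝓝 (0 * Q t + Q t)) := by
    simpa using (h1.mul_const (Q t)).add_const (Q t)
  simp only [add_zero, hint] at h2
  convert h2 using 2 with n
  · rw [sub_mul, mul_assoc, star_mul_of_norm_one (hQn t)]; simp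
  · simp

/-! ### Trajectories and their continuous dependence on the input. -/

/-- The acceleration in the world frame along the orientation `Q`. -/
noncomputable def worldAcc (u : ℝ → Input) (ξ : State) (Q : ℝ → ℍ[ℝ]) (t : ℝ) : E3 :=
  rot (Q t) (trueAcc ξ (u t)) - gravity

/-- The velocity obtained by integrating `worldAcc`. -/
noncomputable def velocity (u : ℝ → Input) (ξ : State) (Q : ℝ → ℍ[ℝ]) (t : ℝ) : E3 :=
  ξ.v + ∫ s in (0 : ℝ)..t, worldAcc u ξ Q s

/-- The motion with initial state `ξ`, input `u` and orientation `Q`. -/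
noncomputable def motion (u : ℝ → Input) (ξ : State) (Q : ℝ → ℍ[ℝ]) (t : ℝ) : State where
  p := ξ.p + ∫ s in (0 : ℝ)..t, velocity u ξ Q s
  v := velocity u ξ Q t
  q := Q t
  ba := ξ.ba
  bω := ξ.bω
  pU := ξ.pU

section Motion

variable {u : ℝ → Input} {ξ : State} {Q : ℝ → ℍ[ℝ]}

theorem IsOrientationOn.continuous {w : ℝ → E3} (hQ : IsOrientationOn w Q Set.univ) :
    Continuous Q :=
  continuous_iff_continuousAt.2 fun t => (hQ t trivial).continuousAt

theorem continuous_worldAcc (hu : Continuous fun t => (u t).acc) (hQ : Continuous Q) :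
    Continuous (worldAcc u ξ Q) :=
  (continuous_rot_prod.comp (hQ.prodMk (hu.sub continuous_const))).sub continuous_const

theorem hasDerivAt_velocity (hu : Continuous fun t => (u t).acc) (hQ : Continuous Q) (t : ℝ) :
    HasDerivAt (velocity u ξ Q) (worldAcc u ξ Q t) t :=
  ((continuous_worldAcc hu hQ).integral_hasStrictDerivAt 0 t).hasDerivAt.const_add ξ.v

theorem continuous_velocity (hu : Continuous fun t => (u t).acc) (hQ : Continuous Q) :
    Continuous (velocity u ξ Q) :=
  continuous_iff_continuousAt.2 fun t => (hasDerivAt_velocity hu hQ t).continuousAt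

theorem hasDerivAt_motion_p (hu : Continuous fun t => (u t).acc) (hQ : Continuous Q) (t : ℝ) :
    HasDerivAt (fun s => (motion u ξ Q s).p) (velocity u ξ Q t) t :=
  ((continuous_velocity hu hQ).integral_hasStrictDerivAt 0 t).hasDerivAt.const_add ξ.p

theorem motion_isTrajectory (hu : Continuous fun t => (u t).acc) (hQ0 : Q 0 = ξ.q)
    (hQ : IsOrientationOn (fun t => trueGyro ξ (u t)) Q Set.univ) :
    IsTrajectory u ξ (motion u ξ Q) := by
  constructor
  · simp [motion, velocity, hQ0]
  · exact fun t _ => (hasDerivAt_motion_p hu hQ.continuous t).hasDerivWithinAt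
  · exact fun t _ => (hasDerivAt_velocity hu hQ.continuous t).hasDerivWithinAt
  · exact fun t _ => (hQ t trivial).hasDerivWithinAt
  · exact fun t _ => hasDerivWithinAt_const _ _ _
  · exact fun t _ => hasDerivWithinAt_const _ _ _
  · exact fun t _ => hasDerivWithinAt_const _ _ _

end Motion

/-- Convergence almost everywhere must suffice, since the pulses do not tend to the reference input
at their centre. -/
theorem tendsto_primitive {E : Type*} [NormedAddCommGroup E] [NormedSpace ℝ E]
    {F : ℕ → ℝ → E} {f : ℝ → E} {g : ℝ → ℝ} (hF : ∀ n, Continuous (F n)) (hg : Continuous g)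
    (hFg : ∀ n s, ‖F n s‖ ≤ g s) (hlim : ∀ᵐ s, Tendsto (fun n => F n s) atTop (𝓝 (f s))) (t : ℝ) :
    Tendsto (fun n => ∫ s in (0 : ℝ)..t, F n s) atTop (𝓝 (∫ s in (0 : ℝ)..t, f s)) :=
  intervalIntegral.tendsto_integral_filter_of_dominated_convergence g
    (Eventually.of_forall fun n => (hF n).aestronglyMeasurable)
    (Eventually.of_forall fun n => Eventually.of_forall fun s _ => hFg n s)
    (hg.intervalIntegrable _ _) (hlim.mono fun _ h _ => h)

/-- Positions, velocities and orientations depend continuously on the input. -/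
theorem tendsto_motion {u : ℝ → Input} {U : ℕ → ℝ → Input} {ξ : State} {Q : ℝ → ℍ[ℝ]}
    {P : ℕ → ℝ → ℍ[ℝ]} (hua : Continuous fun t => (u t).acc) (hug : Continuous fun t => (u t).gyro)
    (hUa : ∀ n, Continuous fun t => (U n t).acc) (hUg : ∀ n, Continuous fun t => (U n t).gyro)
    (hQ : IsOrientationOn (fun t => trueGyro ξ (u t)) Q Set.univ) (hQ0 : Q 0 = ξ.q)
    (hQn : ∀ t, ‖Q t‖ = 1)
    (hP : ∀ n, IsOrientationOn (fun t => trueGyro ξ (U n t)) (P n) Set.univ)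
    (hP0 : ∀ n, P n 0 = ξ.q) (hPn : ∀ n t, ‖P n t‖ = 1) {C D : ℝ}
    (hC : ∀ n t, ‖(U n t).gyro - (u t).gyro‖ ≤ C) (hD : ∀ n t, ‖(U n t).acc - (u t).acc‖ ≤ D)
    (hlimg : ∀ᵐ t, Tendsto (fun n => (U n t).gyro) atTop (𝓝 (u t).gyro))
    (hlima : ∀ᵐ t, Tendsto (fun n => (U n t).acc) atTop (𝓝 (u t).acc)) (t : ℝ) :
    Tendsto (fun n => (motion (U n) ξ (P n) t).p) atTop (𝓝 (motion u ξ Q t).p) ∧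
    Tendsto (fun n => (motion (U n) ξ (P n) t).v) atTop (𝓝 (motion u ξ Q t).v) ∧
    Tendsto (fun n => (motion (U n) ξ (P n) t).q) atTop (𝓝 (motion u ξ Q t).q) := by
  have hq : ∀ t, Tendsto (fun n => P n t) atTop (𝓝 (Q t)) :=
    tendsto_orientation (hug.sub continuous_const) (fun n => (hUg n).sub continuous_const) hQ hP
      hQn hPn (fun n => (hP0 n).trans hQ0.symm) (fun n t => by simpa [trueGyro] using hC n t)
      (hlimg.mono fun t h => h.sub_const _)
  -- Rotations by unit quaternions preserve length, so this bounds the world accelerations uniformly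
  -- in `n`; its primitive then bounds the velocities.
  let g : ℝ → ℝ := fun s => D + ‖trueAcc ξ (u s)‖ + ‖gravity‖
  have hg : Continuous g :=
    (continuous_const.add (hua.sub continuous_const).norm).add continuous_const
  have hac : ∀ n, Continuous (worldAcc (U n) ξ (P n)) := fun n =>
    continuous_worldAcc (hUa n) (hP n).continuous
  have hag : ∀ n s, ‖worldAcc (U n) ξ (P n) s‖ ≤ g s := by
    intro n s
    refine (norm_sub_le _ _).trans (add_le_add_left ?_ _)
    rw [norm_rot (hPn n s)]
    have : trueAcc ξ (U n s) = ((U n s).acc - (u s).acc) + trueAcc ξ (u s) := by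
      simp only [trueAcc]; abel
    rw [this]
    exact (norm_add_le _ _).trans (add_le_add_left (hD n s) _)
  have hv : ∀ t, Tendsto (fun n => velocity (U n) ξ (P n) t) atTop (𝓝 (velocity u ξ Q t)) := by
    intro t
    refine (tendsto_primitive hac hg hag ?_ t).const_add ξ.v
    filter_upwards [hlima] with s hs
    exact ((continuous_rot_prod.tendsto (Q s, trueAcc ξ (u s))).comp
      ((hq s).prodMk_nhds (hs.sub_const ξ.ba))).sub_const gravity
  refine ⟨?_, hv t, hq t⟩
  have hG : Continuous fun r => ‖ξ.v‖ + |∫ s in (0 : ℝ)..r, g s| :=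
    continuous_const.add (intervalIntegral.continuous_primitive
      (fun a b => hg.intervalIntegrable a b) 0).abs
  refine (tendsto_primitive (fun n => continuous_velocity (hUa n) (hP n).continuous) hG
    (fun n r => ?_) (Eventually.of_forall hv) t).const_add ξ.p
  exact (norm_add_le _ _).trans (add_le_add_right
    (intervalIntegral.norm_integral_le_abs_of_norm_le (Eventually.of_forall fun s => hag n s)
      (hg.intervalIntegrable _ _)) _)

/-! ### Output in body-frame form, and the pulse argument. -/

/-- Half the squared range for a prediction `B τ a_t ω_t p_U`, in the IMU frame, of the displacement
of the radio relative to ballistic motion of the IMU. -/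
noncomputable def bodyOutput (B : ℝ → E3 → E3 → E3 → E3) (anchor : E3) (x : State) (u : Input)
    (τ : ℝ) : ℝ :=
  (1 / 2) * ‖anchor - (x.p + τ • x.v - (τ ^ 2 / 2) • gravity
    + rot x.q (B τ (trueAcc x u) (trueGyro x u) x.pU))‖ ^ 2

/-- The sampled input, the biases and `p_U` are the same for all `n`, so the prediction is a
constant vector and no continuity of `B` is needed. -/
theorem tendsto_bodyOutput (B : ℝ → E3 → E3 → E3 → E3) (anchor : E3) {X : ℕ → State} {x : State}
    (hp : Tendsto (fun n => (X n).p) atTop (𝓝 x.p)) (hv : Tendsto (fun n => (X n).v) atTop (𝓝 x.v))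
    (hq : Tendsto (fun n => (X n).q) atTop (𝓝 x.q)) (hba : ∀ n, (X n).ba = x.ba)
    (hbω : ∀ n, (X n).bω = x.bω) (hpU : ∀ n, (X n).pU = x.pU) (u : Input) (τ : ℝ) :
    Tendsto (fun n => bodyOutput B anchor (X n) u τ) atTop (𝓝 (bodyOutput B anchor x u τ)) := by
  simp only [bodyOutput, trueAcc, trueGyro, hba, hbω, hpU]
  generalize B τ (u.acc - x.ba) (u.gyro - x.bω) x.pU = b
  have hr : Tendsto (fun n => rot (X n).q b) atTop (𝓝 (rot x.q b)) :=
    ((continuous_rot_left b).tendsto x.q).comp hq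
  have h : Tendsto (fun n => anchor - ((X n).p + τ • (X n).v - (τ ^ 2 / 2) • gravity
      + rot (X n).q b)) atTop
      (𝓝 (anchor - (x.p + τ • x.v - (τ ^ 2 / 2) • gravity + rot x.q b))) :=
    (((hp.add (hv.const_smul τ)).sub_const _).add hr).const_sub anchor
  exact (h.norm.pow 2).const_mul _

/-- A smooth bump at `s` of width at most `1 / (n + 1)`. -/
noncomputable def shrinkingBump (s : ℝ) (n : ℕ) : ContDiffBump s where
  rIn := 1 / (n + 1) / 2
  rOut := 1 / (n + 1)
  rIn_pos := by positivity
  rIn_lt_rOut := half_lt_self (by positivity)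

theorem shrinkingBump_self (s : ℝ) (n : ℕ) : shrinkingBump s n s = 1 :=
  (shrinkingBump s n).one_of_mem_closedBall
    (Metric.mem_closedBall_self (shrinkingBump s n).rIn_pos.le)

theorem eventually_shrinkingBump_eq_zero {s r : ℝ} (h : r ≠ s) :
    ∀ᶠ n in atTop, shrinkingBump s n r = 0 := by
  have := tendsto_one_div_add_atTop_nhds_zero_nat (𝕜 := ℝ)
  filter_upwards [this.eventually_lt_const (dist_pos.2 h)] with n hn
  exact (shrinkingBump s n).zero_of_le_dist hn.le

/-- The input `u` modified near the time `s` so as to take the value `z` there. -/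
noncomputable def pulse (u : ℝ → Input) (s : ℝ) (z : Input) (n : ℕ) (t : ℝ) : Input where
  acc := (u t).acc + shrinkingBump s n t • (z.acc - (u s).acc)
  gyro := (u t).gyro + shrinkingBump s n t • (z.gyro - (u s).gyro)

theorem pulse_self (u : ℝ → Input) (s : ℝ) (z : Input) (n : ℕ) : pulse u s z n s = z := by
  simp [pulse, shrinkingBump_self]

theorem eventually_pulse_eq (u : ℝ → Input) {s r : ℝ} (h : r ≠ s) (z : Input) :
    ∀ᶠ n in atTop, pulse u s z n r = u r := by
  filter_upwards [eventually_shrinkingBump_eq_zero h] with n hn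
  simp [pulse, hn]

theorem norm_shrinkingBump_smul_le (s : ℝ) (n : ℕ) (t : ℝ) (v : E3) :
    ‖shrinkingBump s n t • v‖ ≤ ‖v‖ := by
  rw [norm_smul, Real.norm_of_nonneg (shrinkingBump s n).nonneg]
  exact mul_le_of_le_one_left (norm_nonneg _) (shrinkingBump s n).le_one

theorem pulse_mem {Ea Eω : Set (Fin 3)} {u : ℝ → Input}
    (hacc : ContDiff ℝ ∞ (fun t => (u t).acc)) (hgyro : ContDiff ℝ ∞ (fun t => (u t).gyro)) {s : ℝ}
    {z : Input} (hza : ∀ j, j ∉ Ea → z.acc j = (u s).acc j)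
    (hzg : ∀ j, j ∉ Eω → z.gyro j = (u s).gyro j) (n : ℕ) :
    pulse u s z n ∈ excitedInputs Ea Eω u := by
  refine ⟨hacc.add ((shrinkingBump s n).contDiff.smul contDiff_const),
    hgyro.add ((shrinkingBump s n).contDiff.smul contDiff_const), fun j hj t => ?_, fun j hj t => ?_⟩
  · simp [pulse, hza j hj]
  · simp [pulse, hzg j hj]

/-- The delay is identifiable as soon as, along the motion driven by the reference input, the output
at some time depends on the value of the excited axes at the single instant at which they are
sampled: a short enough pulse at that instant changes the output of the true system by a fixed
amount, and the output for any other delay by an arbitrarily small one. -/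
theorem locallyIdentifiable_of_sensitive {B : ℝ → E3 → E3 → E3 → E3} {anchor : E3}
    {Ea Eω : Set (Fin 3)} {u : ℝ → Input} (hacc : ContDiff ℝ ∞ (fun t => (u t).acc))
    (hgyro : ContDiff ℝ ∞ (fun t => (u t).gyro)) {T τ₀ : ℝ} (hτ₀ : τ₀ ∈ Set.Ioo 0 T)
    {S : Set State} (hunit : ∀ ξ ∈ S, ‖ξ.q‖ = 1)
    (hsens : ∀ ξ ∈ S, ∀ Q : ℝ → ℍ[ℝ], Continuous Q → (∀ t, ‖Q t‖ = 1) →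
      ∃ t, T ≤ t ∧ ∃ z : Input, (∀ j, j ∉ Ea → z.acc j = (u (t - τ₀)).acc j) ∧
        (∀ j, j ∉ Eω → z.gyro j = (u (t - τ₀)).gyro j) ∧
        bodyOutput B anchor (motion u ξ Q (t - τ₀)) z τ₀ ≠
          bodyOutput B anchor (motion u ξ Q (t - τ₀)) (u (t - τ₀)) τ₀) :
    LocallyIdentifiable (bodyOutput B anchor) (excitedInputs Ea Eω u) S T τ₀ := by
  refine ⟨Set.Ioo 0 T, isOpen_Ioo, hτ₀, subset_rfl, fun τ₁ _ hne ξ₀ hξ₀ ξ₁ hξ₁ => ?_⟩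
  have hua := hacc.continuous
  have hug := hgyro.continuous
  obtain ⟨Q₀, hQ₀0, hQ₀, hQ₀n⟩ := exists_isOrientationOn_univ
    (w := fun t => trueGyro ξ₀ (u t)) (hug.sub continuous_const) (hunit ξ₀ hξ₀)
  obtain ⟨Q₁, hQ₁0, hQ₁, hQ₁n⟩ := exists_isOrientationOn_univ
    (w := fun t => trueGyro ξ₁ (u t)) (hug.sub continuous_const) hξ₁
  obtain ⟨t, ht, z, hza, hzg, hz⟩ := hsens ξ₀ hξ₀ Q₀ hQ₀.continuous hQ₀n
  have hst : t - τ₁ ≠ t - τ₀ := fun h => hne (by linarith)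
  by_contra! hall
  apply hz
  let U : ℕ → ℝ → Input := pulse u (t - τ₀) z
  have hUmem : ∀ n, U n ∈ excitedInputs Ea Eω u := pulse_mem hacc hgyro hza hzg
  have hUa : ∀ n, Continuous fun t => (U n t).acc := fun n => (hUmem n).1.continuous
  have hUg : ∀ n, Continuous fun t => (U n t).gyro := fun n => (hUmem n).2.1.continuous
  have hlim : ∀ᵐ r, ∀ᶠ n in atTop, U n r = u r := by
    filter_upwards [MeasureTheory.compl_mem_ae_iff.2
      (MeasureTheory.measure_singleton (t - τ₀))] with r hr
    exact eventually_pulse_eq u hr z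
  have hD : ∀ n r, ‖(U n r).acc - (u r).acc‖ ≤ ‖z.acc - (u (t - τ₀)).acc‖ := fun n r => by
    simpa [U, pulse] using norm_shrinkingBump_smul_le (t - τ₀) n r (z.acc - (u (t - τ₀)).acc)
  have hC : ∀ n r, ‖(U n r).gyro - (u r).gyro‖ ≤ ‖z.gyro - (u (t - τ₀)).gyro‖ := fun n r => by
    simpa [U, pulse] using norm_shrinkingBump_smul_le (t - τ₀) n r (z.gyro - (u (t - τ₀)).gyro)
  have hlima : ∀ᵐ r, Tendsto (fun n => (U n r).acc) atTop (𝓝 (u r).acc) := hlim.mono fun r h =>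
    tendsto_const_nhds.congr' (h.mono fun n hn => congrArg Input.acc hn.symm)
  have hlimg : ∀ᵐ r, Tendsto (fun n => (U n r).gyro) atTop (𝓝 (u r).gyro) := hlim.mono fun r h =>
    tendsto_const_nhds.congr' (h.mono fun n hn => congrArg Input.gyro hn.symm)
  choose P₀ hP₀0 hP₀ hP₀n using fun n => exists_isOrientationOn_univ
    (w := fun t => trueGyro ξ₀ (U n t)) ((hUg n).sub continuous_const) (hunit ξ₀ hξ₀)
  choose P₁ hP₁0 hP₁ hP₁n using fun n => exists_isOrientationOn_univ
    (w := fun t => trueGyro ξ₁ (U n t)) ((hUg n).sub continuous_const) hξ₁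
  have lim : ∀ (ξ : State) (Q : ℝ → ℍ[ℝ]) (P : ℕ → ℝ → ℍ[ℝ]), Q 0 = ξ.q →
      IsOrientationOn (fun t => trueGyro ξ (u t)) Q Set.univ → (∀ t, ‖Q t‖ = 1) →
      (∀ n, P n 0 = ξ.q) →
      (∀ n, IsOrientationOn (fun t => trueGyro ξ (U n t)) (P n) Set.univ) →
      (∀ n t, ‖P n t‖ = 1) → ∀ (r : ℝ) (y : Input) (τ : ℝ),
      Tendsto (fun n => bodyOutput B anchor (motion (U n) ξ (P n) r) y τ) atTop
        (𝓝 (bodyOutput B anchor (motion u ξ Q r) y τ)) := by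
    intro ξ Q P hQ0 hQ hQn hP0 hP hPn r y τ
    obtain ⟨hp, hv, hq⟩ := tendsto_motion hua hug hUa hUg hQ hQ0 hQn hP hP0 hPn hC hD hlimg hlima r
    exact tendsto_bodyOutput B anchor hp hv hq (fun _ => rfl) (fun _ => rfl) (fun _ => rfl) y τ
  have l₀ := lim ξ₀ Q₀ P₀ hQ₀0 hQ₀ hQ₀n hP₀0 hP₀ hP₀n (t - τ₀) z τ₀
  have l₁ := lim ξ₁ Q₁ P₁ hQ₁0 hQ₁ hQ₁n hP₁0 hP₁ hP₁n (t - τ₁) (u (t - τ₁)) τ₁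
  -- Under the pulse the true system samples `z` for every `n`, while the other one eventually
  -- samples the reference value.
  have heq : (fun n => bodyOutput B anchor (motion (U n) ξ₀ (P₀ n) (t - τ₀)) z τ₀) =ᶠ[atTop]
      fun n => bodyOutput B anchor (motion (U n) ξ₁ (P₁ n) (t - τ₁)) (u (t - τ₁)) τ₁ := by
    filter_upwards [eventually_pulse_eq u hst z] with n hn
    have h := hall (U n) (hUmem n) _ _ (motion_isTrajectory (hUa n) (hP₀0 n) (hP₀ n))
      (motion_isTrajectory (hUa n) (hP₁0 n) (hP₁ n)) t ht
    rwa [show U n (t - τ₀) = z from pulse_self u _ z n, show U n (t - τ₁) = _ from hn] at h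
  -- The true output with sample `z` equals the alternative output along the reference motion, which
  -- by agreement for `u` itself is the true output with sample `u (t - τ₀)`.
  rw [tendsto_nhds_unique (l₀.congr' heq) l₁]
  exact (hall u ⟨hacc, hgyro, fun _ _ _ => rfl, fun _ _ _ => rfl⟩ _ _
    (motion_isTrajectory hua hQ₀0 hQ₀) (motion_isTrajectory hua hQ₁0 hQ₁) t ht).symm

/-! ### Rotation and displacement under a constant input. -/

/-- The rotation accumulated in time `t` at constant angular velocity `w`. -/
noncomputable def spin (w : E3) (t : ℝ) : ℍ[ℝ] :=
  NormedSpace.exp (t • ((1 / 2 : ℝ) • pureQuat w))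

/-- The displacement in time `t`, from rest, under the body-fixed acceleration `a` while rotating at
constant angular velocity `w`. -/
noncomputable def drift (w a : E3) (t : ℝ) : E3 :=
  ∫ s in (0 : ℝ)..t, ∫ r in (0 : ℝ)..s, rot (spin w r) a

theorem norm_spin (w : E3) (t : ℝ) : ‖spin w t‖ = 1 := by
  simp [spin, Quaternion.norm_exp]

theorem spin_zero (w : E3) : spin w 0 = 1 := by simp [spin]

theorem hasDerivAt_spin (w : E3) (t : ℝ) :
    HasDerivAt (spin w) ((1 / 2 : ℝ) • (spin w t * pureQuat w)) t :=
  (hasDerivAt_exp_smul_const (𝕂 := ℝ) ((1 / 2 : ℝ) • pureQuat w) t).congr_deriv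
    (by rw [mul_smul_comm]; rfl)

theorem continuous_spin (w : E3) : Continuous (spin w) :=
  continuous_iff_continuousAt.2 fun t => (hasDerivAt_spin w t).continuousAt

theorem continuous_rot_spin (w a : E3) : Continuous fun t => rot (spin w t) a :=
  continuous_rot (continuous_spin w) a

theorem continuous_integral_rot_spin (w a : E3) :
    Continuous fun s => ∫ r in (0 : ℝ)..s, rot (spin w r) a :=
  intervalIntegral.continuous_primitive
    (fun _ _ => (continuous_rot_spin w a).intervalIntegrable _ _) 0

theorem hasDerivAt_rot_spin (w a : E3) (t : ℝ) :
    HasDerivAt (fun s => rot (spin w s) a) (rot (spin w t) (cross w a)) t :=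
  HasDerivAt.rot_frame (hasDerivAt_spin w t) a

theorem exp_smul_pureQuat {n : E3} (hn : ‖n‖ = 1) (φ : ℝ) :
    NormedSpace.exp (φ • pureQuat n) = (Real.cos φ : ℍ[ℝ]) + Real.sin φ • pureQuat n := by
  rw [Quaternion.exp_of_re_eq_zero _ (by simp), norm_smul, norm_pureQuat, hn, mul_one,
    Real.norm_eq_abs, Real.cos_abs, smul_smul]
  congr 2
  rcases eq_or_ne φ 0 with rfl | hφ
  · simp
  rcases abs_choice φ with h | h <;> rw [h]
  · field_simp
  · rw [Real.sin_neg]; field_simp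

theorem spin_smul {n : E3} (hn : ‖n‖ = 1) (θ t : ℝ) :
    spin (θ • n) t =
      (Real.cos (t * θ / 2) : ℍ[ℝ]) + Real.sin (t * θ / 2) • pureQuat n := by
  rw [spin, pureQuat_smul, smul_smul, smul_smul, exp_smul_pureQuat hn]
  ring_nf

theorem rot_spin_self (w : E3) (t : ℝ) : rot (spin w t) w = w := by
  have h : ∀ t, HasDerivAt (fun s => rot (spin w s) w) 0 t := fun t => by
    simpa [cross_self, rot_zero] using hasDerivAt_rot_spin w w t
  have := is_const_of_deriv_eq_zero (fun t => (h t).differentiableAt) (fun t => (h t).deriv) t 0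
  simpa [spin_zero, rot_one] using this

theorem rot_spin_zero_left (a : E3) (t : ℝ) : rot (spin 0 t) a = a := by
  simp [spin, pureQuat_zero, rot_one]

theorem integral_integral_const (a : E3) (t : ℝ) :
    (∫ s in (0 : ℝ)..t, ∫ _ in (0 : ℝ)..s, a) = (t ^ 2 / 2) • a := by
  simp only [intervalIntegral.integral_const, sub_zero]
  rw [intervalIntegral.integral_smul_const, integral_id]
  simp

theorem drift_self (w : E3) (t : ℝ) : drift w w t = (t ^ 2 / 2) • w := by
  simp only [drift, rot_spin_self, integral_integral_const]

theorem drift_zero_left (a : E3) (t : ℝ) : drift 0 a t = (t ^ 2 / 2) • a := by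
  simp only [drift, rot_spin_zero_left, integral_integral_const]

theorem drift_add (w a b : E3) (t : ℝ) : drift w (a + b) t = drift w a t + drift w b t := by
  have h : ∀ s : ℝ, (∫ r in (0 : ℝ)..s, (rot (spin w r) a + rot (spin w r) b)) =
      (∫ r in (0 : ℝ)..s, rot (spin w r) a) + ∫ r in (0 : ℝ)..s, rot (spin w r) b := fun s =>
    intervalIntegral.integral_add ((continuous_rot_spin w a).intervalIntegrable _ _)
      ((continuous_rot_spin w b).intervalIntegrable _ _)
  simp only [drift, rot_add, h]
  exact intervalIntegral.integral_add
    ((continuous_integral_rot_spin w a).intervalIntegrable _ _)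
    ((continuous_integral_rot_spin w b).intervalIntegrable _ _)

theorem drift_smul (w : E3) (c : ℝ) (a : E3) (t : ℝ) : drift w (c • a) t = c • drift w a t := by
  simp only [drift, rot_smul, intervalIntegral.integral_smul]

theorem drift_zero_right (w : E3) (t : ℝ) : drift w 0 t = 0 := by
  simpa using drift_smul w 0 0 t

/-- The integrand is the second derivative of `rot (spin w ·) a`, so the double integral is its
first-order Taylor remainder at `0`. -/
theorem drift_cross_cross (w a : E3) (t : ℝ) :
    drift w (cross w (cross w a)) t = rot (spin w t) a - a - t • cross w a := by
  have h : ∀ s : ℝ, (∫ r in (0 : ℝ)..s, rot (spin w r) (cross w (cross w a))) =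
      rot (spin w s) (cross w a) - cross w a := fun s => by
    rw [intervalIntegral.integral_eq_sub_of_hasDerivAt
      (fun r _ => hasDerivAt_rot_spin w (cross w a) r)
      ((continuous_rot_spin w _).intervalIntegrable _ _), spin_zero, rot_one]
  simp only [drift, h]
  rw [intervalIntegral.integral_sub ((continuous_rot_spin w _).intervalIntegrable _ _)
    intervalIntegrable_const, intervalIntegral.integral_eq_sub_of_hasDerivAt
      (fun r _ => hasDerivAt_rot_spin w a r) ((continuous_rot_spin w _).intervalIntegrable _ _)]
  simp [spin_zero, rot_one]

/-- Expanding the double cross product gives an implicit closed form of `drift`, used both to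
exclude its vanishing and to evaluate it at full turns. -/
theorem drift_eq (w a : E3) (t : ℝ) :
    ((inner ℝ w a : ℝ) * (t ^ 2 / 2)) • w - ‖w‖ ^ 2 • drift w a t =
      rot (spin w t) a - a - t • cross w a := by
  rw [← drift_cross_cross, cross_cross_self, sub_eq_add_neg, sub_eq_add_neg, ← neg_smul,
    ← neg_smul, drift_add, drift_smul, drift_smul, drift_self, smul_smul]

/-- If the drift vanished with `w ≠ 0`, pairing `drift_eq` with `w`, which the rotation fixes, would
force `a ⟂ w`. What is left says that the rotated `a` equals `a + t • cross w a`; the two summands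
are orthogonal, so this is strictly longer than `a`, a contradiction. -/
theorem drift_ne_zero (w : E3) {a : E3} (ha : a ≠ 0) {t : ℝ} (ht : t ≠ 0) : drift w a t ≠ 0 := by
  intro h0
  have ht2 : t ^ 2 / 2 ≠ 0 := by positivity
  rcases eq_or_ne w 0 with rfl | hw
  · rw [drift_zero_left] at h0
    exact (smul_ne_zero ht2 ha) h0
  have h := drift_eq w a t
  rw [h0, smul_zero, sub_zero] at h
  have hw2 : ‖w‖ ^ 2 ≠ 0 := pow_ne_zero 2 (norm_ne_zero_iff.2 hw)
  have hwa : inner ℝ w a = 0 := by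
    have h1 : inner ℝ w (rot (spin w t) a) = inner ℝ w a := by
      rw [← inner_rot (norm_spin w t) w a, rot_spin_self]
    have h2 := congrArg (fun z => inner ℝ w z) h
    simp only [inner_sub_right, real_inner_smul_right, inner_cross_self_left, h1,
      real_inner_self_eq_norm_sq] at h2
    have h3 : inner ℝ w a * (t ^ 2 / 2 * ‖w‖ ^ 2) = 0 := by linear_combination h2
    exact (mul_eq_zero.1 h3).resolve_right (mul_ne_zero ht2 hw2)
  rw [hwa, zero_mul, zero_smul] at h
  have h4 : rot (spin w t) a = a + t • cross w a := by
    rw [eq_comm, ← sub_eq_zero, ← neg_eq_zero]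
    rw [h]; abel
  have h5 : ‖a‖ ^ 2 = ‖a + t • cross w a‖ ^ 2 := by rw [← h4, norm_rot (norm_spin w t)]
  rw [norm_add_sq_real, real_inner_smul_right, inner_cross_self_right, norm_smul, mul_pow,
    norm_cross_sq, hwa, Real.norm_eq_abs, sq_abs] at h5
  have h6 : t ^ 2 * (‖w‖ ^ 2 * ‖a‖ ^ 2) = 0 := by linear_combination -h5
  exact mul_ne_zero (pow_ne_zero 2 ht)
    (mul_ne_zero hw2 (pow_ne_zero 2 (norm_ne_zero_iff.2 ha))) h6

/-! ### Both observation models in body-frame form. -/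

/-- The first-order prediction in the body frame. -/
noncomputable def bodyEuler (τ : ℝ) (a w p : E3) : E3 := (τ ^ 2 / 2) • a + (p + τ • cross w p)

/-- The exact prediction in the body frame. -/
noncomputable def bodyExact (τ : ℝ) (a w p : E3) : E3 := drift w a τ + rot (spin w τ) p

theorem rangeOutputEuler_eq (anchor : E3) :
    rangeOutputEuler anchor = bodyOutput bodyEuler anchor := by
  funext x u τ
  simp only [rangeOutputEuler, bodyOutput, radioPosEuler, bodyEuler]
  rw [rot_add x.q ((τ ^ 2 / 2) • _), rot_smul]
  congr 4
  module

theorem integral_rot (q : ℍ[ℝ]) {f : ℝ → E3} (hf : Continuous f) (t : ℝ) :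
    ∫ s in (0 : ℝ)..t, rot q (f s) = rot q (∫ s in (0 : ℝ)..t, f s) :=
  (LinearMap.toContinuousLinearMap (rotL q)).intervalIntegral_comp_comm
    (hf.intervalIntegrable _ _)

theorem heldVel_eq (x : State) (u : Input) (s : ℝ) :
    heldVel x u s = x.v + (rot x.q (∫ r in (0 : ℝ)..s, rot (spin (trueGyro x u) r) (trueAcc x u))
      - s • gravity) := by
  have h : ∀ r, rot (heldOri x u r) (trueAcc x u) =
      rot x.q (rot (spin (trueGyro x u) r) (trueAcc x u)) := fun r => rot_mul _ _ _
  have hc := continuous_rot_spin (trueGyro x u) (trueAcc x u)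
  have hc' : Continuous fun r => rot x.q (rot (spin (trueGyro x u) r) (trueAcc x u)) :=
    (LinearMap.toContinuousLinearMap (rotL x.q)).continuous.comp hc
  simp only [heldVel, h]
  rw [intervalIntegral.integral_sub (hc'.intervalIntegrable _ _) intervalIntegrable_const,
    integral_rot _ hc, intervalIntegral.integral_const, sub_zero]

theorem heldPos_eq (x : State) (u : Input) (t : ℝ) :
    heldPos x u t = x.p + t • x.v - (t ^ 2 / 2) • gravity
      + rot x.q (drift (trueGyro x u) (trueAcc x u) t) := by
  have hc := continuous_integral_rot_spin (trueGyro x u) (trueAcc x u)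
  have hc' : Continuous fun s =>
      rot x.q (∫ r in (0 : ℝ)..s, rot (spin (trueGyro x u) r) (trueAcc x u)) :=
    (LinearMap.toContinuousLinearMap (rotL x.q)).continuous.comp hc
  have hg : Continuous fun s : ℝ => s • gravity := continuous_id.smul continuous_const
  have hd : Continuous fun s =>
      rot x.q (∫ r in (0 : ℝ)..s, rot (spin (trueGyro x u) r) (trueAcc x u)) - s • gravity :=
    hc'.sub hg
  have hI : ∫ s in (0 : ℝ)..t, s • gravity = (t ^ 2 / 2) • gravity := by
    rw [intervalIntegral.integral_smul_const, integral_id]; simp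
  simp only [heldPos, heldVel_eq]
  rw [intervalIntegral.integral_add intervalIntegrable_const (hd.intervalIntegrable _ _),
    intervalIntegral.integral_sub (hc'.intervalIntegrable _ _) (hg.intervalIntegrable _ _),
    integral_rot _ hc, hI, intervalIntegral.integral_const, sub_zero, drift]
  module

theorem rangeOutput_eq (anchor : E3) : rangeOutput anchor = bodyOutput bodyExact anchor := by
  funext x u τ
  have h : radioPos (held x u τ) = rot (x.q * spin (trueGyro x u) τ) x.pU + heldPos x u τ := rfl
  simp only [rangeOutput, bodyOutput, bodyExact, h]
  rw [heldPos_eq, rot_mul, rot_add x.q (drift _ _ _)]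
  congr 4
  abel

/-! ### Dependence of the range on the sampled input. -/

theorem exists_norm_add_smul_ne (c : E3) {d : E3} (hd : d ≠ 0) : ∃ σ : ℝ, ‖c + σ • d‖ ≠ ‖c‖ := by
  by_contra! h
  have h1 := norm_add_sq_real c ((1 : ℝ) • d)
  have h2 := norm_add_sq_real c ((-1 : ℝ) • d)
  rw [h] at h1 h2
  simp only [one_smul, neg_smul, norm_neg, inner_neg_right] at h1 h2
  have : 0 < ‖d‖ ^ 2 := by positivity
  linarith

/-- A line meets a sphere in at most two points, and here three collinear points have the same norm.
-/
theorem eq_zero_of_norm_eq {c d : E3} (h1 : ‖c + d‖ = ‖c - d‖)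
    (h2 : ‖c + (1 / 2 : ℝ) • d‖ = ‖c + d‖) : d = 0 := by
  have e1 := norm_add_sq_real c d
  have e2 := norm_sub_sq_real c d
  have e3 := norm_add_sq_real c ((1 / 2 : ℝ) • d)
  rw [real_inner_smul_right, norm_smul, Real.norm_of_nonneg (by norm_num), mul_pow] at e3
  rw [h1] at e1
  rw [h2, h1] at e3
  have : ‖d‖ ^ 2 = 0 := by linarith
  exact norm_eq_zero.1 (pow_eq_zero_iff two_ne_zero |>.1 this)

/-- Whole turns about an axis `n ⟂ a` leave the lever arm `p` unrotated, while the drift is a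
multiple of `cross n a` that varies with the number and sense of the turns. This puts three
collinear points on one sphere. -/
theorem exists_bodyExact_gyro_ne_of_acc {q : ℍ[ℝ]} (hq : ‖q‖ = 1) {τ : ℝ} (hτ : 0 < τ) (c p : E3)
    {a : E3} (ha : a ≠ 0) (w₀ : E3) :
    ∃ w, ‖c - rot q (bodyExact τ a w p)‖ ≠ ‖c - rot q (bodyExact τ a w₀ p)‖ := by
  by_contra! hall
  obtain ⟨n, hn, hna⟩ := exists_unit_orthogonal a
  have key : ∀ θ : ℝ, θ ≠ 0 → (∀ b, rot (spin (θ • n) τ) b = b) →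
      c - rot q (bodyExact τ a (θ • n) p) = c - rot q p + (-τ / θ) • rot q (cross n a) := by
    intro θ hθ hrot
    have h := drift_eq (θ • n) a τ
    rw [hrot, real_inner_smul_left, hna, norm_smul, hn, cross_smul_left, mul_zero, zero_mul,
      zero_smul, zero_sub, sub_self, zero_sub, neg_inj, mul_one, Real.norm_eq_abs, sq_abs] at h
    have h' : drift (θ • n) a τ = (τ / θ) • cross n a := by
      have hθ2 : θ ^ 2 ≠ 0 := pow_ne_zero 2 hθ
      rw [← inv_smul_smul₀ hθ2 (drift _ _ _), h, smul_smul, smul_smul]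
      congr 1
      field_simp
    rw [bodyExact, hrot, h', rot_add, rot_smul]
    module
  have hτ' := hτ.ne'
  have hπ := Real.pi_ne_zero
  -- One turn backward, one forward and two backward displace the vector by `d`, `-d` and `d / 2`,
  -- where `d` is `τ ^ 2 / (2 * π)` times the rotated `cross n a`.
  have k1 := key (-(2 * Real.pi / τ)) (by simp [hτ', hπ]) fun b => by
    rw [spin_smul hn, show τ * -(2 * Real.pi / τ) / 2 = -Real.pi by field_simp]
    simp [rot_neg_one]
  have k2 := key (2 * Real.pi / τ) (by simp [hτ', hπ]) fun b => by
    rw [spin_smul hn, show τ * (2 * Real.pi / τ) / 2 = Real.pi by field_simp]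
    simp [rot_neg_one]
  have k3 := key (-(4 * Real.pi / τ)) (by simp [hτ', hπ]) fun b => by
    rw [spin_smul hn, show τ * -(4 * Real.pi / τ) / 2 = -(2 * Real.pi) by field_simp; norm_num]
    simp [rot_one]
  have hd := eq_zero_of_norm_eq (c := c - rot q p)
    (d := (τ ^ 2 / (2 * Real.pi)) • rot q (cross n a)) (by
      have := (hall (-(2 * Real.pi / τ) • n)).trans (hall ((2 * Real.pi / τ) • n)).symm
      rw [k1, k2] at this
      convert this using 2
      · congr 2; field_simp
      · rw [sub_eq_add_neg, ← neg_smul]; congr 2; field_simp) (by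
      have := (hall (-(4 * Real.pi / τ) • n)).trans (hall (-(2 * Real.pi / τ) • n)).symm
      rw [k1, k3] at this
      convert this using 2
      · rw [smul_smul]; congr 2; field_simp; norm_num
      · congr 2; field_simp)
  have hx : rot q (cross n a) = 0 := (smul_eq_zero.1 hd).resolve_left (by positivity)
  have hx2 : ‖cross n a‖ ^ 2 = 0 := by rw [← norm_rot hq, hx]; simp
  rw [norm_cross_sq, hn, hna] at hx2
  have : 0 < ‖a‖ ^ 2 := by positivity
  linarith

/-- Without acceleration only the rotated lever arm moves, on a sphere, so a constant range means a
constant inner product with the anchor direction. Half turns about two well-chosen axes refute this.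
-/
theorem exists_bodyExact_gyro_ne_of_offset {q : ℍ[ℝ]} (hq : ‖q‖ = 1) {τ : ℝ} (hτ : 0 < τ)
    {c p : E3} (hc : c ≠ 0) (hp : p ≠ 0) (w₀ : E3) :
    ∃ w, ‖c - rot q (bodyExact τ 0 w p)‖ ≠ ‖c - rot q (bodyExact τ 0 w₀ p)‖ := by
  by_contra! hall
  have hτ' := hτ.ne'
  have hsq : ‖star q‖ = 1 := by rw [norm_star, hq]
  set e := rot (star q) c with he
  have hec : rot q e = c := by rw [he, ← rot_mul, mul_star_of_norm_one hq, rot_one]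
  have he0 : 0 < ‖e‖ := by rw [he, norm_rot hsq]; exact norm_pos_iff.2 hc
  have hp0 : 0 < ‖p‖ := norm_pos_iff.2 hp
  have hin : ∀ w, inner ℝ e (rot (spin w τ) p) = inner ℝ e p := by
    intro w
    have h := congrArg (· ^ 2) ((hall w).trans (hall 0).symm)
    simp only [bodyExact, drift_zero_right, zero_add, rot_spin_zero_left] at h
    rw [← hec, ← rot_sub, ← rot_sub, norm_rot hq, norm_rot hq, norm_sub_sq_real, norm_sub_sq_real,
      norm_rot (norm_spin _ _)] at h
    linarith
  -- A half turn about `n` sends `p` to `2⟨n, p⟩n - p`, to be compared with no rotation at all.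
  have hunit : ∀ n : E3, ‖n‖ = 1 → inner ℝ n p * inner ℝ n e = inner ℝ e p := by
    intro n hn
    have h := hin ((Real.pi / τ) • n)
    rw [spin_smul hn, show τ * (Real.pi / τ) / 2 = Real.pi / 2 by field_simp] at h
    simp only [Real.cos_pi_div_two, Real.sin_pi_div_two, Quaternion.coe_zero, zero_add, one_smul,
      rot_pureQuat hn, inner_sub_right, real_inner_smul_right] at h
    rw [real_inner_comm e n]
    linarith
  obtain ⟨n, hn, hnp⟩ := exists_unit_orthogonal p
  have hep : inner ℝ e p = 0 := by rw [← hunit n hn, hnp, zero_mul]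
  -- The bisector of the now orthogonal `e` and `p` has positive inner product with each, whereas
  -- `hunit` makes the product of these zero.
  set x := ‖e‖ • p + ‖p‖ • e with hx
  have hxp : inner ℝ x p = ‖e‖ * ‖p‖ ^ 2 := by
    rw [hx, inner_add_left, real_inner_smul_left, real_inner_smul_left, hep,
      real_inner_self_eq_norm_sq]; ring
  have hxe : inner ℝ x e = ‖p‖ * ‖e‖ ^ 2 := by
    rw [hx, inner_add_left, real_inner_smul_left, real_inner_smul_left, real_inner_comm, hep,
      real_inner_self_eq_norm_sq]; ring
  have hx0 : x ≠ 0 := by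
    intro h
    rw [h, inner_zero_left] at hxp
    exact (by positivity : ‖e‖ * ‖p‖ ^ 2 ≠ 0) hxp.symm
  have h := hunit (‖x‖⁻¹ • x) (by
    rw [norm_smul, norm_inv, norm_norm, inv_mul_cancel₀ (norm_ne_zero_iff.2 hx0)])
  rw [real_inner_smul_left, real_inner_smul_left, hxp, hxe, hep] at h
  have : 0 < ‖x‖ := norm_pos_iff.2 hx0
  exact (by positivity : ‖x‖⁻¹ * (‖e‖ * ‖p‖ ^ 2) * (‖x‖⁻¹ * (‖p‖ * ‖e‖ ^ 2)) ≠ 0) h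

/-! ### Identifiability from accelerometer or gyroscope excitation. -/

/-- The anchor relative to the ballistic prediction of the position of the IMU. -/
noncomputable def anchorOffset (anchor : E3) (x : State) (τ : ℝ) : E3 :=
  anchor - (x.p + τ • x.v - (τ ^ 2 / 2) • gravity)

theorem bodyOutput_ne {B : ℝ → E3 → E3 → E3 → E3} {anchor : E3} {x : State} {u z : Input} {τ : ℝ}
    (h : ‖anchorOffset anchor x τ - rot x.q (B τ (trueAcc x z) (trueGyro x z) x.pU)‖ ≠
      ‖anchorOffset anchor x τ - rot x.q (B τ (trueAcc x u) (trueGyro x u) x.pU)‖) :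
    bodyOutput B anchor x z τ ≠ bodyOutput B anchor x u τ := by
  intro heq
  apply h
  simp only [bodyOutput, ← sub_sub anchor] at heq
  exact (sq_eq_sq₀ (norm_nonneg _) (norm_nonneg _)).1 (mul_left_cancel₀ (by norm_num) heq)

theorem rot_ne_zero {q : ℍ[ℝ]} (hq : ‖q‖ = 1) {v : E3} (hv : v ≠ 0) : rot q v ≠ 0 := by
  rw [← norm_pos_iff, norm_rot hq]; exact norm_pos_iff.2 hv

theorem exists_rot_add_smul_ne {q : ℍ[ℝ]} (hq : ‖q‖ = 1) (c b : E3) {d : E3} (hd : d ≠ 0) :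
    ∃ σ : ℝ, ‖c - rot q (b + σ • d)‖ ≠ ‖c - rot q b‖ := by
  obtain ⟨σ, hσ⟩ := exists_norm_add_smul_ne (c - rot q b) (neg_ne_zero.2 (rot_ne_zero hq hd))
  refine ⟨σ, ?_⟩
  convert hσ using 2
  rw [rot_add, rot_smul]
  module

/-- One excited accelerometer axis suffices if the prediction is affine and non-degenerate in the
acceleration. -/
theorem locallyIdentifiable_of_acc {B : ℝ → E3 → E3 → E3 → E3} {anchor : E3} {Ea Eω : Set (Fin 3)}
    {u : ℝ → Input} (hacc : ContDiff ℝ ∞ (fun t => (u t).acc))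
    (hgyro : ContDiff ℝ ∞ (fun t => (u t).gyro)) {T τ : ℝ} (hτ : τ ∈ Set.Ioo 0 T)
    {S : Set State} (hunit : ∀ ξ ∈ S, ‖ξ.q‖ = 1) {j : Fin 3} (hj : j ∈ Ea)
    (hB : ∀ a w p e : E3, e ≠ 0 → ∃ d ≠ 0, ∀ σ : ℝ, B τ (a + σ • e) w p = B τ a w p + σ • d) :
    LocallyIdentifiable (bodyOutput B anchor) (excitedInputs Ea Eω u) S T τ := by
  refine locallyIdentifiable_of_sensitive hacc hgyro hτ hunit fun ξ _ Q _ hQn => ⟨T, le_rfl, ?_⟩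
  set x := motion u ξ Q (T - τ)
  set y := u (T - τ)
  obtain ⟨d, hd, hBd⟩ := hB (trueAcc x y) (trueGyro x y) x.pU (EuclideanSpace.single j 1) (by simp)
  obtain ⟨σ, hσ⟩ := exists_rot_add_smul_ne (q := x.q) (hQn _) (anchorOffset anchor x τ)
    (B τ (trueAcc x y) (trueGyro x y) x.pU) hd
  refine ⟨⟨y.acc + σ • EuclideanSpace.single j 1, y.gyro⟩, fun i hi => ?_, fun _ _ => rfl,
    bodyOutput_ne ?_⟩
  · have : i ≠ j := fun h => hi (h ▸ hj)
    simp [this]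
  · rw [← hBd] at hσ
    have e : trueAcc x ⟨y.acc + σ • EuclideanSpace.single j 1, y.gyro⟩ =
        trueAcc x y + σ • EuclideanSpace.single j 1 := add_sub_right_comm _ _ _
    rw [e]
    exact hσ

/-- A freely falling IMU does not stay at the ballistic preimage of the anchor. -/
theorem exists_anchorOffset_ne_zero_or_trueAcc_ne_zero {u : ℝ → Input} {ξ : State} {Q : ℝ → ℍ[ℝ]}
    (hu : Continuous fun t => (u t).acc) (hQ : Continuous Q) (anchor : E3) (T τ : ℝ) :
    ∃ t, T ≤ t ∧ (anchorOffset anchor (motion u ξ Q (t - τ)) τ ≠ 0 ∨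
      trueAcc ξ (u (t - τ)) ≠ 0) := by
  by_contra! h
  have h1 : ∀ s, T - τ ≤ s → anchorOffset anchor (motion u ξ Q s) τ = 0 ∧ trueAcc ξ (u s) = 0 :=
    fun s hs => by simpa using h (s + τ) (by linarith)
  have hfall : ∀ s, T - τ ≤ s → HasDerivAt (velocity u ξ Q) (-gravity) s := fun s hs =>
    (hasDerivAt_velocity hu hQ s).congr_deriv (by simp [worldAcc, (h1 s hs).2, rot_zero])
  -- Differentiating the vanishing offset in free fall pins the velocity to the constant `τ •
  -- gravity`, which contradicts its derivative `-gravity`. The strict inequality provides the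
  -- two-sided neighbourhood.
  have hv : ∀ s, T - τ < s → velocity u ξ Q s = τ • gravity := by
    intro s hs
    have hd : HasDerivAt (fun r => anchorOffset anchor (motion u ξ Q r) τ)
        (-(velocity u ξ Q s + τ • -gravity)) s :=
      (((hasDerivAt_motion_p hu hQ s).add ((hfall s hs.le).const_smul τ)).sub_const _).const_sub _
    have hz : HasDerivAt (fun r => anchorOffset anchor (motion u ξ Q r) τ) 0 s :=
      (hasDerivAt_const s (0 : E3)).congr_of_eventuallyEq
        ((eventually_gt_nhds hs).mono fun r hr => (h1 r hr.le).1)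
    have := hd.unique hz
    rwa [neg_eq_zero, smul_neg, ← sub_eq_add_neg, sub_eq_zero] at this
  have hs : T - τ < T - τ + 1 := lt_add_one _
  have hz : HasDerivAt (velocity u ξ Q) 0 (T - τ + 1) :=
    (hasDerivAt_const _ (τ • gravity)).congr_of_eventuallyEq
      ((eventually_gt_nhds hs).mono fun r hr => hv r hr)
  have hg := congrArg (fun z : E3 => z 2) ((hfall _ hs.le).unique hz)
  have h2 : gravity 2 = 9.8 := rfl
  simp only [PiLp.neg_apply, PiLp.zero_apply, h2] at hg
  norm_num at hg

/-- Three excited gyroscope axes suffice if the prediction depends on the angular velocity whenever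
the anchor offset or the acceleration does not vanish. -/
theorem locallyIdentifiable_of_gyro {B : ℝ → E3 → E3 → E3 → E3} {anchor : E3} {Ea Eω : Set (Fin 3)}
    {u : ℝ → Input} (hacc : ContDiff ℝ ∞ (fun t => (u t).acc))
    (hgyro : ContDiff ℝ ∞ (fun t => (u t).gyro)) {T τ : ℝ} (hτ : τ ∈ Set.Ioo 0 T)
    {S : Set State} (hunit : ∀ ξ ∈ S, ‖ξ.q‖ = 1) (hpU : ∀ ξ ∈ S, ξ.pU ≠ 0) (hE : ∀ j, j ∈ Eω)
    (hB : ∀ (q : ℍ[ℝ]) (c a w p : E3), ‖q‖ = 1 → p ≠ 0 → (c ≠ 0 ∨ a ≠ 0) →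
      ∃ w', ‖c - rot q (B τ a w' p)‖ ≠ ‖c - rot q (B τ a w p)‖) :
    LocallyIdentifiable (bodyOutput B anchor) (excitedInputs Ea Eω u) S T τ := by
  refine locallyIdentifiable_of_sensitive hacc hgyro hτ hunit fun ξ hξ Q hQ hQn => ?_
  obtain ⟨t, ht, hne⟩ := exists_anchorOffset_ne_zero_or_trueAcc_ne_zero (ξ := ξ) hacc.continuous hQ
    anchor T τ
  refine ⟨t, ht, ?_⟩
  set x := motion u ξ Q (t - τ)
  set y := u (t - τ)
  obtain ⟨w, hw⟩ := hB x.q (anchorOffset anchor x τ) (trueAcc x y) (trueGyro x y) x.pU (hQn _)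
    (hpU ξ hξ) hne
  refine ⟨⟨y.acc, w + x.bω⟩, fun _ _ => rfl, fun j hj => absurd (hE j) hj, bodyOutput_ne ?_⟩
  have e : trueGyro x ⟨y.acc, w + x.bω⟩ = w := add_sub_cancel_right w x.bω
  rw [e]
  exact hw

theorem bodyExact_acc (τ : ℝ) (hτ : τ ≠ 0) (a w p e : E3) (he : e ≠ 0) :
    ∃ d ≠ 0, ∀ σ : ℝ, bodyExact τ (a + σ • e) w p = bodyExact τ a w p + σ • d := by
  refine ⟨drift w e τ, drift_ne_zero w he hτ, fun σ => ?_⟩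
  rw [bodyExact, bodyExact, drift_add, drift_smul]
  abel

theorem bodyEuler_acc (τ : ℝ) (hτ : τ ≠ 0) (a w p e : E3) (he : e ≠ 0) :
    ∃ d ≠ 0, ∀ σ : ℝ, bodyEuler τ (a + σ • e) w p = bodyEuler τ a w p + σ • d := by
  refine ⟨(τ ^ 2 / 2) • e, smul_ne_zero (by positivity) he, fun σ => ?_⟩
  rw [bodyEuler, bodyEuler]
  module

/-- The first-order prediction is affine in the angular velocity, with slope `τ • cross v p` along
`v`, so the line-and-sphere argument applies directly. -/
theorem exists_bodyEuler_gyro_ne {q : ℍ[ℝ]} (hq : ‖q‖ = 1) {τ : ℝ} (hτ : τ ≠ 0) (c a w₀ : E3)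
    {p : E3} (hp : p ≠ 0) :
    ∃ w, ‖c - rot q (bodyEuler τ a w p)‖ ≠ ‖c - rot q (bodyEuler τ a w₀ p)‖ := by
  obtain ⟨v, hv⟩ := exists_cross_ne_zero hp
  obtain ⟨σ, hσ⟩ := exists_rot_add_smul_ne hq c (bodyEuler τ a w₀ p) (smul_ne_zero hτ hv)
  refine ⟨w₀ + σ • v, ?_⟩
  convert hσ using 4
  rw [bodyEuler, bodyEuler, cross_add_left, cross_smul_left]
  module

end UwbImu

theorem theorem1 (anchor : UwbImu.E3) (Ea Eω : Set (Fin 3)) (u₀ : ℝ → UwbImu.Input)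
    (hacc : ContDiff ℝ ∞ (fun t => (u₀ t).acc)) (hgyro : ContDiff ℝ ∞ (fun t => (u₀ t).gyro))
    (T td : ℝ) (htd : td ∈ Set.Ioo 0 T) (S : Set UwbImu.State)
    (hunit : ∀ ξ ∈ S, ‖ξ.q‖ = 1)
    (hT1 : ∀ ξ ∈ S, UwbImu.radioPos ξ ≠ anchor)
    (hT23 : (∃ j, j ∈ Ea) ∨ ((∀ ξ ∈ S, ξ.pU ≠ 0) ∧ ∀ j, j ∈ Eω)) :
    UwbImu.LocallyIdentifiable (UwbImu.rangeOutput anchor)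
        (UwbImu.excitedInputs Ea Eω u₀) S T td ∧
      UwbImu.LocallyIdentifiable (UwbImu.rangeOutputEuler anchor)
        (UwbImu.excitedInputs Ea Eω u₀) S T td := by
  open UwbImu in
  rw [rangeOutput_eq, rangeOutputEuler_eq]
  have hne : td ≠ 0 := htd.1.ne'
  rcases hT23 with ⟨j, hj⟩ | ⟨hpU, hE⟩
  · exact ⟨locallyIdentifiable_of_acc hacc hgyro htd hunit hj (bodyExact_acc td hne),
      locallyIdentifiable_of_acc hacc hgyro htd hunit hj (bodyEuler_acc td hne)⟩
  · refine ⟨locallyIdentifiable_of_gyro hacc hgyro htd hunit hpU hE fun q c a w p hq hp h => ?_,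
      locallyIdentifiable_of_gyro hacc hgyro htd hunit hpU hE fun q c a w p hq hp _ =>
        exists_bodyEuler_gyro_ne hq hne c a w hp⟩
    -- Without acceleration the drift is zero and the nonvanishing anchor offset is needed;
    -- otherwise the drift alone reveals the rotation.
    by_cases ha : a = 0
    · subst ha
      exact exists_bodyExact_gyro_ne_of_offset hq htd.1 (h.resolve_right fun h => h rfl) hp w
    · exact exists_bodyExact_gyro_ne_of_acc hq htd.1 c p ha w
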